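/- **Setting.** Consider a multi-objective adversarial bandit with $K$ arms, $D$-dimensional rewards and horizon $T$. In each round $t=1,\dots,T$ an adversary assigns to every arm $i$ a reward vector $r^{i,t}\in[0,1]^D$. The player then pulls an arm $a_t$ and sees only $r^{a_t,t}$. A randomized algorithm chooses $a_t$ (measurably) from a private random seed and from the arms it pulled and the reward vectors it received in earlier rounds. The adversary chooses the rewards from its own independent random seed and from the past actions $a_1,\dots,a_{t-1}$ of the player (an *adaptive* adversary). It is *oblivious* if the rewards do not depend on the past actions. We say that *rewards repeat* if always $r^{i,t}=(r^{i,t}_1,\dots,r^{i,t}_1)$. A vector $b$ dominates $a$ if $b_d\ge a_d$ for all $d$, with strict inequality for some $d$. Let $O'$ be the set of those cumulative reward vectors $\sum_{t\le T}r^{i,t}$, $i=1,\dots,K$, that are not dominated by another vector $\sum_{t\le T}r^{j,t}$. For a vector $a$ and a set $O$ let $$\mathrm{Dist}(a,O)=\inf\{\varepsilon\ge 0:\ \text{no }\sigma\in O\text{ dominates } a+\varepsilon\mathbf 1\}.$$ The (realized) Pareto regret is $R'_T=\mathrm{Dist}\bigl(\sum_{t\le T}r^{a_t,t},\,O'\bigr)$.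 **Theorem 8.** Let $\delta\in(0,1)$. 1. There are $c>0$ and $T_0$, depending only on $\delta$, such that for all $K\ge2$, $D\ge1$ and $T\ge T_0$ there is an adversary whose rewards repeat and for which every randomized algorithm satisfies $\mathbb P\bigl(R'_T>c\sqrt T\bigr)\ge 1-\delta$. 2. There are $K_0$ and $T_0$, depending only on $\delta$, such that for all $K\ge K_0$, $D\ge1$ and $T\ge T_0$ there is an oblivious adversary whose rewards repeat and for which every randomized algorithm satisfies $\mathbb P\bigl(R'_T>\sqrt T\bigr)\ge 1-\delta$. The probability is over the independent random seeds of the algorithm and of the adversary. -/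

import Mathlib

open MeasureTheory

namespace MOMAB

/-- An adversary for a bandit with `K` arms and `D`-dimensional rewards.  Before the game it draws a
private seed; in round `t` (rounds are `0, 1, 2, …`) it assigns to every arm a reward vector in
`[0,1]^D`, as a function of the seed and of the actions that the player took in the earlier
rounds. -/
structure Adversary (K D : ℕ) where
  Seed : Type
  [measSeed : MeasurableSpace Seed]
  law : Measure Seed
  [probLaw : IsProbabilityMeasure law]
  reward : (t : ℕ) → Seed → (Fin t → Fin K) → Fin K → Fin D → ℝ
  reward_mem : ∀ t θ h i d, reward t θ h i d ∈ Set.Icc (0 : ℝ) 1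
  measurable_reward : ∀ t h i d, Measurable fun θ => reward t θ h i d

attribute [instance] Adversary.measSeed Adversary.probLaw

/-- The adversary is oblivious: its rewards do not depend on the past actions of the player. -/
def Adversary.IsOblivious {K D : ℕ} (adv : Adversary K D) : Prop :=
  ∀ t θ h h', adv.reward t θ h = adv.reward t θ h'

/-- Every reward vector repeats one value in all coordinates. -/
def Adversary.HasRepeatedRewards {K D : ℕ} (adv : Adversary K D) : Prop :=
  ∀ t θ h i d d', adv.reward t θ h i d = adv.reward t θ h i d'

/-- A randomized algorithm.  It draws a private seed, and in round `t` it chooses an arm as a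
function of the seed and of what it saw in the rounds before `t`: the arms that it pulled, and the
reward vectors of these arms only. -/
structure Algorithm (K D : ℕ) where
  Seed : Type*
  [measSeed : MeasurableSpace Seed]
  law : Measure Seed
  [probLaw : IsProbabilityMeasure law]
  act : (t : ℕ) → Seed → (Fin t → Fin K × (Fin D → ℝ)) → Fin K
  measurable_act : ∀ t, Measurable
    fun p : Seed × (Fin t → Fin K × (Fin D → ℝ)) => act t p.1 p.2

attribute [instance] Algorithm.measSeed Algorithm.probLaw

section Play

variable {K D : ℕ} (alg : Algorithm K D) (adv : Adversary K D) (ω : alg.Seed) (θ : adv.Seed)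

/-- The pairs (arm pulled, reward vector received) of the first `t` rounds of the game, for given
seeds of the two sides. -/
def transcript : (t : ℕ) → Fin t → Fin K × (Fin D → ℝ)
  | 0 => Fin.elim0
  | t + 1 =>
    let past := transcript t
    let a := alg.act t ω past
    Fin.snoc (α := fun _ => Fin K × (Fin D → ℝ)) past
      (a, adv.reward t θ (fun s => (past s).1) a)

/-- The arm `a_t` that the player pulls in round `t`. -/
def action (t : ℕ) : Fin K := alg.act t ω (transcript alg adv ω θ t)

/-- The reward vector `r^{i,t}` that the adversary assigns to arm `i` in round `t`. -/
def armReward (t : ℕ) (i : Fin K) : Fin D → ℝ :=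
  adv.reward t θ (fun s => (transcript alg adv ω θ t s).1) i

/-- The cumulative reward vector of arm `i` over `T` rounds. -/
def armTotal (T : ℕ) (i : Fin K) : Fin D → ℝ :=
  ∑ t ∈ Finset.range T, armReward alg adv ω θ t i

/-- The cumulative reward vector of the player over `T` rounds. -/
def playerTotal (T : ℕ) : Fin D → ℝ :=
  ∑ t ∈ Finset.range T, armReward alg adv ω θ t (action alg adv ω θ t)

end Play

/-- The Pareto optimal front of a family of vectors: those vectors of the family that no vector of
the family dominates.  On `Fin D → ℝ`, `x < y` says that `x d ≤ y d` for all `d`, with a strict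
inequality for at least one `d`; that is, `y` dominates `x`. -/
def paretoFront {K D : ℕ} (X : Fin K → Fin D → ℝ) : Set (Fin D → ℝ) :=
  {σ | ∃ i, σ = X i ∧ ∀ j, ¬ X i < X j}

/-- The vector `a + ε 1`. -/
def shift {D : ℕ} (a : Fin D → ℝ) (ε : ℝ) : Fin D → ℝ := fun d => a d + ε

/-- The Pareto distance from a vector `a` to a set `O`: the infimum of the `ε ≥ 0` for which no `σ ∈ O`
dominates `a + ε 1`. -/
noncomputable def paretoDist {D : ℕ} (a : Fin D → ℝ) (O : Set (Fin D → ℝ)) : ℝ :=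
  sInf {ε : ℝ | 0 ≤ ε ∧ ∀ σ ∈ O, ¬ shift a ε < σ}

/-- Two vectors are incomparable: each is strictly larger than the other in some coordinate. -/
def Incomparable {D : ℕ} (a b : Fin D → ℝ) : Prop :=
  (∃ d, b d < a d) ∧ ∃ d, a d < b d

/-- Whenever some shift `a + ε 1` with `ε ≥ 0` is incomparable with all elements of `O`, the Pareto
distance is the infimum of these `ε`.  (If all vectors are multiples of `1`, there is no such
shift.) -/
theorem paretoDist_eq_incomparable {D : ℕ} (a : Fin D → ℝ) (O : Set (Fin D → ℝ))
    (h : {ε : ℝ | 0 ≤ ε ∧ ∀ σ ∈ O, Incomparable (shift a ε) σ}.Nonempty) :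
    paretoDist a O = sInf {ε : ℝ | 0 ≤ ε ∧ ∀ σ ∈ O, Incomparable (shift a ε) σ} := by
  have hsub : {ε : ℝ | 0 ≤ ε ∧ ∀ σ ∈ O, Incomparable (shift a ε) σ} ⊆
      {ε : ℝ | 0 ≤ ε ∧ ∀ σ ∈ O, ¬ shift a ε < σ} := by
    rintro ε ⟨h0, h1⟩
    refine ⟨h0, fun σ hσ hlt => ?_⟩
    obtain ⟨⟨d, hd⟩, -⟩ := h1 σ hσ
    exact absurd (hlt.le d) (not_le.mpr hd)
  have hbm : BddBelow {ε : ℝ | 0 ≤ ε ∧ ∀ σ ∈ O, ¬ shift a ε < σ} := ⟨0, fun _ hx => hx.1⟩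
  have hbl : BddBelow {ε : ℝ | 0 ≤ ε ∧ ∀ σ ∈ O, Incomparable (shift a ε) σ} :=
    ⟨0, fun _ hx => hx.1⟩
  refine le_antisymm (csInf_le_csInf hbm h hsub) (le_csInf (h.mono hsub) ?_)
  rintro ε ⟨h0, h1⟩
  obtain ⟨η, hη0, hη⟩ := h
  by_cases hle : η ≤ ε
  · exact (csInf_le hbl ⟨hη0, hη⟩).trans hle
  · push Not at hle
    refine le_of_forall_gt_imp_ge_of_dense fun ε' hε' => ?_
    by_cases h2 : η ≤ ε'
    · exact (csInf_le hbl ⟨hη0, hη⟩).trans h2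
    · push Not at h2
      refine csInf_le hbl ⟨h0.trans hε'.le, fun σ hσ => ?_⟩
      obtain ⟨-, d', hd'⟩ := hη σ hσ
      refine ⟨?_, d', ?_⟩
      · by_contra hcon
        push Not at hcon
        refine h1 σ hσ (Pi.lt_def.mpr ⟨fun d => ?_, d', ?_⟩)
        · have := hcon d
          simp only [shift] at this ⊢
          linarith
        · have := hcon d'
          simp only [shift] at this ⊢
          linarith
      · simp only [shift] at hd' ⊢
        linarith

/-- The (realized) Pareto regret after `T` rounds, for given seeds of the two sides. -/
noncomputable def paretoRegret {K D : ℕ} (alg : Algorithm K D) (adv : Adversary K D) (T : ℕ)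
    (ω : alg.Seed) (θ : adv.Seed) : ℝ :=
  paretoDist (playerTotal alg adv ω θ T) (paretoFront (armTotal alg adv ω θ T))

/-- The probability, over the independent seeds of the algorithm and of the adversary, that the
Pareto regret after `T` rounds is larger than `x`. -/
noncomputable def probRegretGT {K D : ℕ} (alg : Algorithm K D) (adv : Adversary K D) (T : ℕ)
    (x : ℝ) : ℝ :=
  (alg.law.prod adv.law).real {p | x < paretoRegret alg adv T p.1 p.2}

end MOMAB

/-! With repeated rewards, regret is the scalar gap to the best arm. Fix the seed of the algorithm:
play is then deterministic given the adversary's coins, and it suffices to count the bad coin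
sequences. In round `t` the action depends on earlier coins only, so relabelling the coins of round
`t` according to that action is injective (`injective_of_triangular`). This removes the algorithm
from the count.

Adaptive case: a fair coin rewards either arm `0` or all the other arms. Whatever is pulled, the sum
of the regrets against arms `0` and `1` makes a fair `±1` step. Such a walk reaches a small multiple
of `√T` within `T` steps with probability near one, although it need not stay there. The adversary
therefore pays nothing once the level is reached, which freezes the regret (`card_survivors_le`,
`hitAndStop_card_le`).

Oblivious case: all rewards are independent fair coins. The player's income is distributed as that
of one fixed arm, so it rarely exceeds its mean by much more than `√T`. Each arm exceeds a larger
multiple of `√T` with a probability bounded below independently of `T`, so among many arms some arm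
does (`coinFlips_card_player_le`, `le_card_le_signSum`). -/

/-! ### Counting seeds -/

/-- A map of sequences whose `t`-th value determines the `t`-th entry, once the earlier entries are
known, is injective. -/
theorem injective_of_triangular {α : Type*} {T : ℕ} (F : (Fin T → α) → Fin T → α)
    (h : ∀ θ θ' t, (∀ s < t, θ s = θ' s) → F θ t = F θ' t → θ t = θ' t) :
    Function.Injective F := by
  intro θ θ' hF
  funext t
  induction t using WellFoundedLT.induction with
  | ind t ih => exact h θ θ' t ih (congrFun hF t)

/-- Fubini reduces the probability to a count for each fixed `ω`. Since `E` need not be measurable,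
Fubini is applied to its measurable hull, whose sections contain those of `E`. -/
theorem one_sub_le_prod_uniformOn_real {Ω Θ : Type*} [MeasurableSpace Ω] [Fintype Θ] [Nonempty Θ]
    [MeasurableSpace Θ] [MeasurableSingletonClass Θ] (μ : Measure Ω) [IsProbabilityMeasure μ]
    (E : Set (Ω × Θ)) (δ : ℝ)
    (h : ∀ ω, (Nat.card {θ // (ω, θ) ∉ E} : ℝ) ≤ δ * Fintype.card Θ) :
    1 - δ ≤ (μ.prod (ProbabilityTheory.uniformOn (Set.univ : Set Θ))).real E := by
  classical
  have : IsProbabilityMeasure (ProbabilityTheory.uniformOn (Set.univ : Set Θ)) :=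
    ProbabilityTheory.isProbabilityMeasure_uniformOn Set.finite_univ Set.univ_nonempty
  have hsec : ∀ ω, ENNReal.ofReal (1 - δ) ≤
      ProbabilityTheory.uniformOn (Set.univ : Set Θ) (Prod.mk ω ⁻¹' E) := by
    intro ω
    refine ENNReal.ofReal_le_of_le_toReal ?_
    change _ ≤ (ProbabilityTheory.uniformOn (Set.univ : Set Θ)).real (Prod.mk ω ⁻¹' E)
    have hc := probReal_compl_eq_one_sub (μ := ProbabilityTheory.uniformOn (Set.univ : Set Θ))
      (Set.toFinite (Prod.mk ω ⁻¹' E)).measurableSet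
    have hv : (ProbabilityTheory.uniformOn (Set.univ : Set Θ)).real (Prod.mk ω ⁻¹' E)ᶜ =
        (Nat.card {θ // (ω, θ) ∉ E} : ℝ) / Fintype.card Θ := by
      rw [Measure.real, ProbabilityTheory.uniformOn_univ,
        Measure.count_apply (Set.toFinite _).measurableSet, ENNReal.toReal_div,
        ← Set.Finite.cast_ncard_eq (Set.toFinite _), ← Nat.card_coe_set_eq]
      simp only [ENat.toENNReal_coe, ENNReal.toReal_natCast]
      rfl
    have hpos : (0 : ℝ) < Fintype.card Θ := by exact_mod_cast Fintype.card_pos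
    have := (div_le_iff₀ hpos).mpr (h ω)
    linarith
  rw [Measure.real, ← ENNReal.ofReal_le_iff_le_toReal (measure_ne_top _ _)]
  calc ENNReal.ofReal (1 - δ) = ∫⁻ _, ENNReal.ofReal (1 - δ) ∂μ := by simp
    _ ≤ ∫⁻ ω, ProbabilityTheory.uniformOn (Set.univ : Set Θ) (Prod.mk ω ⁻¹' E) ∂μ :=
        lintegral_mono hsec
    _ ≤ ∫⁻ ω, ProbabilityTheory.uniformOn (Set.univ : Set Θ) (Prod.mk ω ⁻¹' toMeasurable
          (μ.prod (ProbabilityTheory.uniformOn (Set.univ : Set Θ))) E) ∂μ :=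
        lintegral_mono fun ω => measure_mono (Set.preimage_mono (subset_toMeasurable _ E))
    _ = _ := by
        rw [← Measure.prod_apply (measurableSet_toMeasurable _ E), measure_toMeasurable]

namespace MOMAB

/-! ### Dependence on the past, and regret as a scalar gap -/

section Play

variable {K D : ℕ} (alg : Algorithm K D) (adv : Adversary K D) (ω : alg.Seed)

theorem transcript_fst (θ : adv.Seed) (t : ℕ) (s : Fin t) :
    (transcript alg adv ω θ t s).1 = action alg adv ω θ s := by
  induction t with
  | zero => exact s.elim0
  | succ t ih =>
    refine Fin.lastCases ?_ (fun s => ?_) s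
    · simp [transcript, action]
    · simpa [transcript] using ih s

/-- The actions up to round `t` depend on the seed of the adversary only through the rewards of the
rounds before `t`. -/
theorem action_congr {θ θ' : adv.Seed} {t : ℕ}
    (h : ∀ s < t, adv.reward s θ = adv.reward s θ') :
    action alg adv ω θ t = action alg adv ω θ' t := by
  have key : transcript alg adv ω θ t = transcript alg adv ω θ' t := by
    induction t with
    | zero => rfl
    | succ t ih =>
      have := ih fun s hs => h s (by omega)
      simp only [transcript, this, h t (by omega)]
  simp only [action, key]

/-- All totals are multiples of the vector `1`, so domination is the order of the reals and a best
arm lies on the front. Shifts smaller than the gap to it remain dominated. -/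
theorem lt_paretoRegret (hrep : adv.HasRepeatedRewards) (θ : adv.Seed) (T : ℕ) (d : Fin D)
    (j : Fin K) {x : ℝ} (hx : 0 ≤ x)
    (h : x < armTotal alg adv ω θ T j d - playerTotal alg adv ω θ T d) :
    x < paretoRegret alg adv T ω θ := by
  have harm : ∀ i e, armTotal alg adv ω θ T i e = armTotal alg adv ω θ T i d := by
    intro i e
    simp only [armTotal, Finset.sum_apply, armReward]
    exact Finset.sum_congr rfl fun t _ => hrep _ _ _ _ _ _
  have hpl : ∀ e, playerTotal alg adv ω θ T e = playerTotal alg adv ω θ T d := by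
    intro e
    simp only [playerTotal, Finset.sum_apply, armReward]
    exact Finset.sum_congr rfl fun t _ => hrep _ _ _ _ _ _
  obtain ⟨i, -, hi⟩ := Finset.exists_max_image Finset.univ
    (fun i => armTotal alg adv ω θ T i d) ⟨j, Finset.mem_univ j⟩
  have hji := hi j (Finset.mem_univ j)
  have hfront : armTotal alg adv ω θ T i ∈ paretoFront (armTotal alg adv ω θ T) := by
    refine ⟨i, rfl, fun k hk => ?_⟩
    obtain ⟨-, e, he⟩ := Pi.lt_def.mp hk
    rw [harm, harm k] at he
    exact absurd (hi k (Finset.mem_univ k)) (not_le.mpr he)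
  refine lt_of_lt_of_le (b := armTotal alg adv ω θ T i d - playerTotal alg adv ω θ T d)
    (by linarith) (le_csInf ?_ ?_)
  -- The infimum of the empty set would be `0`, so an admissible shift is needed: the gap to the
  -- best arm.
  · refine ⟨armTotal alg adv ω θ T i d - playerTotal alg adv ω θ T d, by linarith, ?_⟩
    rintro σ ⟨k, rfl, -⟩ hlt
    obtain ⟨-, e, he⟩ := Pi.lt_def.mp hlt
    have := hi k (Finset.mem_univ k)
    simp only [shift, harm k e, hpl e] at he
    linarith
  · rintro ε ⟨-, hε⟩
    by_contra! hcon
    refine hε _ hfront (Pi.lt_def.mpr ⟨fun e => ?_, d, ?_⟩)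
    · simp only [shift, harm i e, hpl e]
      linarith
    · simp only [shift]
      linarith

end Play

/-- The sign `±1` of a coin flip. -/
def sgn (b : Bool) : ℤ := if b then 1 else -1

/-- A finite sequence of coin flips, continued by `true`. -/
def extend {T : ℕ} (θ : Fin T → Bool) (s : ℕ) : Bool := if h : s < T then θ ⟨s, h⟩ else true

/-! ### Random walks below a level -/

section Survival

open Finset

/-- The `±1` sequences of length `n` whose partial sums stay below the level `a`. -/
def survivors (n : ℕ) (a : ℤ) : Finset (Fin n → Bool) :=
  {θ | ∀ k ≤ n, ∑ s ∈ range k, sgn (extend θ s) < a}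

theorem survivors_cons {n : ℕ} {a : ℤ} {b : Bool} {θ : Fin n → Bool}
    (h : (Fin.cons b θ : Fin (n + 1) → Bool) ∈ survivors (n + 1) a) :
    θ ∈ survivors n (a - sgn b) := by
  simp only [survivors, mem_filter, mem_univ, true_and] at h ⊢
  intro k hk
  have h1 := h (k + 1) (by omega)
  rw [sum_range_succ'] at h1
  have h0 : extend (Fin.cons b θ : Fin (n + 1) → Bool) 0 = b := by simp [extend]
  have h2 : ∀ s ∈ range k, extend (Fin.cons b θ : Fin (n + 1) → Bool) (s + 1) = extend θ s := by
    intro s hs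
    have : s < n := by have := mem_range.mp hs; omega
    rw [extend, extend, dif_pos this, dif_pos (Nat.succ_lt_succ this)]
    exact Fin.cons_succ (α := fun _ => Bool) b θ ⟨s, this⟩
  rw [sum_congr rfl fun s hs => by rw [h2 s hs], h0] at h1
  linarith

theorem card_survivors_succ_le (n : ℕ) (a : ℤ) :
    #(survivors (n + 1) a) ≤ #(survivors n (a - 1)) + #(survivors n (a + 1)) := by
  classical
  have hsub : survivors (n + 1) a ⊆
      (survivors n (a - 1)).image (Fin.cons (α := fun _ => Bool) true) ∪
        (survivors n (a + 1)).image (Fin.cons (α := fun _ => Bool) false) := by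
    intro θ hθ
    rw [← Fin.cons_self_tail θ] at hθ ⊢
    have := survivors_cons hθ
    cases hb : θ 0 <;> rw [hb] at this
    · exact mem_union_right _ (mem_image_of_mem _ (by simpa [sgn] using this))
    · exact mem_union_left _ (mem_image_of_mem _ (by simpa [sgn] using this))
  exact (card_le_card hsub).trans ((card_union_le _ _).trans
    (add_le_add card_image_le card_image_le))

/-- The number of paths of length `n` below level `a`, by the potential `L² - ((L - a)⁺)²`, whose
mean decreases by one in each step. -/
theorem card_survivors_le {N L : ℕ} (hL : N ≤ L ^ 2) (n : ℕ) (hn : n ≤ N) (a : ℤ) (ha : 0 ≤ a) :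
    (N : ℤ) * #(survivors n a) ≤ 2 ^ n * ((L : ℤ) ^ 2 - (max (L - a) 0) ^ 2 + N - n) := by
  have hL' : (N : ℤ) ≤ (L : ℤ) ^ 2 := by exact_mod_cast hL
  have hcard : ∀ m : ℕ, ∀ b, (#(survivors m b) : ℤ) ≤ 2 ^ m := by
    intro m b
    have := card_le_univ (survivors m b)
    simp only [Fintype.card_pi, Fintype.card_bool, prod_const, card_univ, Fintype.card_fin] at this
    exact_mod_cast this
  have hN0 : (0 : ℤ) ≤ N := Int.natCast_nonneg N
  have hL0 : (0 : ℤ) ≤ L := Int.natCast_nonneg L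
  induction n generalizing a with
  | zero =>
    have hsq : (max ((L : ℤ) - a) 0) ^ 2 ≤ (L : ℤ) ^ 2 :=
      pow_le_pow_left₀ (le_max_right _ _) (max_le (by linarith) hL0) 2
    have := mul_le_mul_of_nonneg_left (hcard 0 a) hN0
    simp only [pow_zero, mul_one, one_mul, Nat.cast_zero] at this ⊢
    linarith
  | succ n ih =>
    have hnN : ((n + 1 : ℕ) : ℤ) ≤ N := by exact_mod_cast hn
    have hp : (0 : ℤ) < 2 ^ (n + 1) := by positivity
    rcases ha.eq_or_lt with rfl | hpos
    · have : survivors (n + 1) 0 = ∅ := by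
        refine filter_eq_empty_iff.mpr fun θ _ h => ?_
        simpa using h 0 (by omega)
      rw [this, max_eq_left (by linarith)]
      simp only [card_empty, Nat.cast_zero, mul_zero, sub_zero, sub_self, zero_add]
      exact mul_nonneg hp.le (by linarith)
    -- For `a ≥ L` the potential is `L² ≥ N ≥ n`, and the trivial bound `2 ^ n` on the count
    -- suffices. Below `L`, both neighbours `a ± 1` lie on the quadratic piece, whose second
    -- difference is `-2`.
    · rcases le_or_gt (L : ℤ) a with h | h
      · rw [max_eq_right (by linarith)]
        have := mul_le_mul_of_nonneg_left (hcard (n + 1) a) hN0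
        nlinarith
      · have h1 := ih (by omega) (a - 1) (by omega)
        have h2 := ih (by omega) (a + 1) (by omega)
        rw [max_eq_left (by linarith)] at h1 ⊢
        rw [max_eq_left (by linarith)] at h2
        have h3 : (#(survivors (n + 1) a) : ℤ) ≤ #(survivors n (a - 1)) + #(survivors n (a + 1)) := by
          exact_mod_cast card_survivors_succ_le n a
        have h4 := mul_le_mul_of_nonneg_left h3 hN0
        push_cast
        rw [pow_succ]
        linarith

/-- The sum of the steps until the partial sums reach the level `a` is at least `a`, if they do so
at all. -/
theorem le_sum_until_hit (ξ : ℕ → ℤ) (a : ℤ) (T : ℕ) (hit : ℕ → Prop) [DecidablePred hit]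
    (hh : ∀ t, hit t ↔ ∃ k ≤ t, a ≤ ∑ s ∈ range k, ξ s) (h : hit T) :
    a ≤ ∑ t ∈ range T, if hit t then 0 else ξ t := by
  -- `hit t` looks only at steps before `t`, so the step that first reaches the level still counts
  -- and all later ones vanish.
  suffices H : ∀ T, (¬ hit T → (∑ t ∈ range T, if hit t then 0 else ξ t) = ∑ t ∈ range T, ξ t) ∧
      (hit T → a ≤ ∑ t ∈ range T, if hit t then 0 else ξ t) from (H T).2 h
  intro T
  induction T with
  | zero =>
    refine ⟨by simp, fun h => ?_⟩
    obtain ⟨k, hk, h⟩ := (hh 0).mp h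
    obtain rfl : k = 0 := by omega
    simpa using h
  | succ T ih =>
    have hmono : hit T → hit (T + 1) := fun h => by
      obtain ⟨k, hk, h⟩ := (hh T).mp h
      exact (hh _).mpr ⟨k, by omega, h⟩
    rw [sum_range_succ, sum_range_succ]
    by_cases hT : hit T
    · exact ⟨fun h => absurd (hmono hT) h, fun _ => by simpa [hT] using ih.2 hT⟩
    · simp only [hT, if_false, ih.1 hT]
      refine ⟨fun _ => trivial, fun h => ?_⟩
      obtain ⟨k, hk, h⟩ := (hh _).mp h
      rcases hk.eq_or_lt with rfl | hk
      · rwa [sum_range_succ] at h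
      · exact absurd ((hh T).mpr ⟨k, by omega, h⟩) hT

end Survival

/-! ### The adaptive adversary -/

section Adaptive

open Finset

/-- The sum of the regrets against arm `0` and against the other arms changes by this amount if arm
`i` is pulled when the coin shows `b`. -/
def regretStep {K : ℕ} (b : Bool) (i : Fin K) : ℤ := if i.1 = 0 then sgn b else -sgn b

/-- The sum of the regrets has reached the level `a` by round `t`. -/
def levelReached {K : ℕ} (T : ℕ) (a : ℤ) (t : ℕ) (θ : Fin T → Bool) (h : Fin t → Fin K) : Prop :=
  ∃ k ≤ t, a ≤ ∑ s : Fin t, if s.1 < k then regretStep (extend θ s) (h s) else 0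

open Classical in
/-- The adversary that gives reward one either to arm `0` or to all other arms, by the flip of a
coin, until the sum of the player's regrets against these has reached the level `a`. -/
noncomputable def hitAndStop (K D T : ℕ) (a : ℤ) : Adversary K D where
  Seed := Fin T → Bool
  law := ProbabilityTheory.uniformOn Set.univ
  probLaw := ProbabilityTheory.isProbabilityMeasure_uniformOn Set.finite_univ Set.univ_nonempty
  reward t θ h i _ := if levelReached T a t θ h then 0 else
    if (i.1 = 0 ↔ extend θ t = false) then 1 else 0
  reward_mem t θ h i d := by
    split_ifs <;> simp
  measurable_reward t h i d := measurable_of_finite _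

theorem levelReached_congr {K T t : ℕ} {a : ℤ} {θ θ' : Fin T → Bool} (h : Fin t → Fin K)
    (hθ : ∀ s < t, extend θ s = extend θ' s) :
    levelReached T a t θ h ↔ levelReached T a t θ' h := by
  simp only [levelReached]
  refine exists_congr fun k => and_congr_right fun _ => ?_
  rw [sum_congr rfl fun s _ => by rw [hθ s s.2]]

/-- Before the stop exactly one of `i0`, `i1` is paid, so the left side is `1 - 2r`, where `r ∈ {0,
1}` is the reward of `i`. -/
theorem hitAndStop_reward_diff {K D T : ℕ} (a : ℤ) (θ : Fin T → Bool) (t : ℕ)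
    (h : Fin t → Fin K) {i0 i1 : Fin K} (h0 : i0.1 = 0) (h1 : i1.1 ≠ 0) (i : Fin K) (d : Fin D)
    [Decidable (levelReached T a t θ h)] :
    (hitAndStop K D T a).reward t θ h i0 d + (hitAndStop K D T a).reward t θ h i1 d
      - 2 * (hitAndStop K D T a).reward t θ h i d =
      ((if levelReached T a t θ h then 0 else regretStep (extend θ t) i : ℤ) : ℝ) := by
  simp only [hitAndStop, regretStep]
  by_cases hl : levelReached T a t θ h
  · simp [hl]
  · by_cases ha : i.1 = 0 <;> cases hb : extend θ t <;> simp [hl, ha, h0, h1, sgn] <;> norm_num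

/-- The two regrets add up to the stopped walk, which ends at `a` or above; hence one of them is at
least `a / 2`. -/
theorem hitAndStop_regret {K D T : ℕ} (hK : 2 ≤ K) (a : ℤ)
    (alg : Algorithm K D) (ω : alg.Seed) (θ : Fin T → Bool) (d : Fin D)
    (hhit : ∃ k ≤ T, a ≤ ∑ s ∈ range k,
      regretStep (extend θ s) (action alg (hitAndStop K D T a) ω θ s)) :
    ∃ j, (a : ℝ) / 2 ≤ armTotal alg (hitAndStop K D T a) ω θ T j d -
      playerTotal alg (hitAndStop K D T a) ω θ T d := by
  classical
  let act : ℕ → Fin K := fun t => action alg (hitAndStop K D T a) ω θ t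
  let ξ : ℕ → ℤ := fun s => regretStep (extend θ s) (act s)
  have harm : ∀ t i, armReward alg (hitAndStop K D T a) ω θ t i d =
      (hitAndStop K D T a).reward t θ (fun s => act s) i d := by
    intro t i
    have h : (fun s => (transcript alg (hitAndStop K D T a) ω θ t s).1) =
        fun s : Fin t => act s := funext (transcript_fst alg (hitAndStop K D T a) ω θ t)
    exact congrArg (fun h => (hitAndStop K D T a).reward t θ h i d) h
  have hreach : ∀ t, levelReached T a t θ (fun s => act s) ↔
      ∃ k ≤ t, a ≤ ∑ s ∈ range k, ξ s := by
    intro t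
    refine exists_congr fun k => and_congr_right fun hk => ?_
    have : (∑ s : Fin t, if s.1 < k then regretStep (extend θ s) (act s) else 0) =
        ∑ s ∈ range k, ξ s := by
      rw [Fin.sum_univ_eq_sum_range (fun s => if s < k then ξ s else 0) t, ← sum_filter]
      congr 1
      ext s
      simp only [mem_filter, mem_range]
      omega
    rw [this]
  have hsum := le_sum_until_hit ξ a T
    (fun t => levelReached T a t θ (fun s => act s)) hreach ((hreach T).mpr hhit)
  let i0 : Fin K := ⟨0, by omega⟩
  let i1 : Fin K := ⟨1, by omega⟩
  have htot : armTotal alg (hitAndStop K D T a) ω θ T i0 d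
      + armTotal alg (hitAndStop K D T a) ω θ T i1 d
      - 2 * playerTotal alg (hitAndStop K D T a) ω θ T d =
      ((∑ t ∈ range T, if levelReached T a t θ (fun s => act s) then 0 else ξ t : ℤ) : ℝ) := by
    simp only [armTotal, playerTotal, Finset.sum_apply, harm]
    rw [Int.cast_sum, mul_sum, ← sum_add_distrib, ← sum_sub_distrib]
    exact sum_congr rfl fun t _ =>
      hitAndStop_reward_diff a θ t (fun s => act s) rfl one_ne_zero (act t) d
  have hsum' : (a : ℝ) ≤ armTotal alg (hitAndStop K D T a) ω θ T i0 d
      + armTotal alg (hitAndStop K D T a) ω θ T i1 d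
      - 2 * playerTotal alg (hitAndStop K D T a) ω θ T d := by
    rw [htot]
    exact_mod_cast hsum
  by_contra! hcon
  have h0 := hcon i0
  have h1 := hcon i1
  linarith

theorem hitAndStop_card_le {K D T : ℕ} (hK : 2 ≤ K) (hD : 1 ≤ D) (a : ℤ) {x : ℝ} (hx : 0 ≤ x)
    (hxa : x < a / 2) (alg : Algorithm K D) (ω : alg.Seed) :
    Nat.card {θ : Fin T → Bool // ¬ x < paretoRegret alg (hitAndStop K D T a) T ω θ} ≤
      #(survivors T a) := by
  classical
  -- `F θ` lists the signs of the walk's steps, ignoring the stop. It is injective, and seeds with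
  -- small regret give walks that never reach `a`.
  let F : (Fin T → Bool) → Fin T → Bool := fun θ t =>
    if (action alg (hitAndStop K D T a) ω θ t).1 = 0 then θ t else !θ t
  have hrep : (hitAndStop K D T a).HasRepeatedRewards := fun _ _ _ _ _ _ => rfl
  have hF : Function.Injective F := by
    refine injective_of_triangular F fun θ θ' t h hFt => ?_
    have hext : ∀ s < t.1, extend θ s = extend θ' s := by
      intro s hs
      have hsT : s < T := hs.trans t.2
      simpa [extend, hsT] using h ⟨s, hsT⟩ hs
    have hact : action alg (hitAndStop K D T a) ω θ t =
        action alg (hitAndStop K D T a) ω θ' t := by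
      refine action_congr alg (hitAndStop K D T a) ω fun s hs => ?_
      funext h i d
      simp only [hitAndStop]
      rw [hext s hs]
      congr 1
      exact propext (levelReached_congr h fun r hr => hext r (hr.trans hs))
    simp only [F, hact] at hFt
    split_ifs at hFt
    · exact hFt
    · simpa using hFt
  have hsurv : ∀ θ, ¬ x < paretoRegret alg (hitAndStop K D T a) T ω θ → F θ ∈ survivors T a := by
    intro θ hθ
    simp only [survivors, mem_filter, mem_univ, true_and]
    by_contra! hcon
    obtain ⟨k, hk, hle⟩ := hcon
    refine hθ ?_
    have hstep : ∀ s ∈ range k, sgn (extend (F θ) s) =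
        regretStep (extend θ s) (action alg (hitAndStop K D T a) ω θ s) := by
      intro s hs
      have hsT : s < T := by have := mem_range.mp hs; omega
      simp only [extend, hsT, dif_pos, F, regretStep]
      split_ifs
      · rfl
      · cases θ ⟨s, hsT⟩ <;> simp [sgn]
    rw [sum_congr rfl hstep] at hle
    obtain ⟨j, hj⟩ := hitAndStop_regret hK a alg ω θ ⟨0, hD⟩ ⟨k, hk, hle⟩
    exact lt_paretoRegret alg (hitAndStop K D T a) ω hrep θ T ⟨0, hD⟩ j hx (by linarith)
  rw [← Nat.card_eq_finsetCard]
  exact Nat.card_le_card_of_injective (fun θ => (⟨F θ.1, hsurv θ.1 θ.2⟩ : survivors T a))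
    fun θ θ' h => Subtype.ext (hF (congrArg Subtype.val h))

end Adaptive

/-! ### Tails of sums of signs -/

section CoinSums

open Finset

/-- The sum of the signs of `T` coin flips. -/
def signSum {T : ℕ} (ε : Fin T → Bool) : ℝ := ∑ t, (sgn (ε t) : ℝ)

theorem sum_exp_mul_signSum (T : ℕ) (l : ℝ) :
    ∑ ε : Fin T → Bool, Real.exp (l * signSum ε) = 2 ^ T * Real.cosh l ^ T := by
  classical
  have h := prod_univ_sum (fun _ : Fin T => (univ : Finset Bool))
    (fun _ b => Real.exp (l * (sgn b : ℝ)))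
  rw [Fintype.piFinset_univ] at h
  simp only [signSum, mul_sum, Real.exp_sum]
  rw [← h, ← mul_pow]
  simp [sgn, Real.cosh_eq]
  congr 1
  ring

/-- Exponential Markov inequality with parameter `1 / √T`, where `cosh x ≤ exp (x ^ 2 / 2)` bounds
the mean by `exp (1 / 2)`. -/
theorem card_lt_signSum_le {T : ℕ} (hT : 1 ≤ T) (C : ℝ) :
    (#{ε : Fin T → Bool | C * √T < signSum ε} : ℝ) ≤ Real.exp (1 / 2 - C) * 2 ^ T := by
  have hT0 : (0 : ℝ) < T := by exact_mod_cast hT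
  have hs : 0 < √(T : ℝ) := Real.sqrt_pos.mpr hT0
  have hss : √(T : ℝ) ^ 2 = T := Real.sq_sqrt hT0.le
  have h1 : (#{ε : Fin T → Bool | C * √T < signSum ε} : ℝ) * Real.exp C ≤
      ∑ ε : Fin T → Bool, Real.exp (1 / √T * signSum ε) := by
    rw [← nsmul_eq_mul]
    refine (card_nsmul_le_sum _ _ _ fun ε hε => ?_).trans
      (sum_le_univ_sum_of_nonneg fun _ => (Real.exp_pos _).le)
    rw [mem_filter] at hε
    refine Real.exp_le_exp.mpr ?_
    rw [one_div, inv_mul_eq_div, le_div_iff₀ hs]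
    exact hε.2.le
  have h2 : Real.cosh (1 / √T) ^ T ≤ Real.exp (1 / 2) := by
    calc Real.cosh (1 / √T) ^ T ≤ Real.exp ((1 / √T) ^ 2 / 2) ^ T :=
          pow_le_pow_left₀ (Real.cosh_pos _).le (Real.cosh_le_exp_half_sq _) _
      _ = Real.exp (1 / 2) := by
          rw [← Real.exp_nat_mul, div_pow, hss]
          congr 1
          field_simp
  rw [sum_exp_mul_signSum] at h1
  rw [Real.exp_sub, div_mul_eq_mul_div, le_div_iff₀ (Real.exp_pos _), mul_comm (Real.exp (1 / 2))]
  exact h1.trans (mul_le_mul_of_nonneg_left h2 (by positivity))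

theorem exp_sq_div_four_le_cosh {x : ℝ} (hx : x ^ 2 ≤ 1) : Real.exp (x ^ 2 / 4) ≤ Real.cosh x := by
  have h0 : 0 ≤ x ^ 2 := sq_nonneg x
  have h1 : 1 + x ^ 2 / 2 ≤ Real.cosh x := by
    have h2 : Real.cosh x = 1 + 2 * Real.sinh (x / 2) ^ 2 := by
      have := Real.cosh_two_mul (x / 2)
      rw [Real.cosh_sq, mul_div_cancel₀ x two_ne_zero] at this
      linarith
    have h3 : (x / 2) ^ 2 ≤ Real.sinh (x / 2) ^ 2 := by
      rw [sq_le_sq, Real.abs_sinh]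
      exact Real.self_le_sinh_iff.mpr (abs_nonneg _)
    rw [h2]
    nlinarith
  refine le_trans ?_ h1
  have h4 : 1 - x ^ 2 / 4 ≤ Real.exp (-(x ^ 2 / 4)) := by
    have := Real.add_one_le_exp (-(x ^ 2 / 4))
    linarith
  have h5 : Real.exp (x ^ 2 / 4) * Real.exp (-(x ^ 2 / 4)) = 1 := by
    rw [← Real.exp_add, add_neg_cancel, Real.exp_zero]
  have h6 := Real.exp_pos (x ^ 2 / 4)
  have h7 : Real.exp (x ^ 2 / 4) * (1 - x ^ 2 / 4) ≤ 1 :=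
    (mul_le_mul_of_nonneg_left h4 h6.le).trans h5.le
  nlinarith

/-- Compares the second moment of the exponential of a sign with the square of its mean. For `T`
signs and `x = κ / √T` the ratio is at most `exp (κ ^ 2)`, independently of `T`. -/
theorem cosh_two_mul_le (x : ℝ) : Real.cosh (2 * x) ≤ Real.cosh x ^ 2 * Real.exp (x ^ 2) := by
  have h1 : Real.cosh x ^ 2 ≤ Real.exp (x ^ 2) := by
    calc Real.cosh x ^ 2 ≤ Real.exp (x ^ 2 / 2) ^ 2 :=
          pow_le_pow_left₀ (Real.cosh_pos _).le (Real.cosh_le_exp_half_sq _) _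
      _ = Real.exp (x ^ 2) := by
          rw [← Real.exp_nat_mul]
          congr 1
          push_cast
          ring
  have h2 : 1 - x ^ 2 ≤ Real.exp (-x ^ 2) := by
    have := Real.add_one_le_exp (-x ^ 2)
    linarith
  have h3 : Real.cosh x ^ 2 * (1 - x ^ 2) ≤ 1 := by
    calc Real.cosh x ^ 2 * (1 - x ^ 2) ≤ Real.cosh x ^ 2 * Real.exp (-x ^ 2) :=
          mul_le_mul_of_nonneg_left h2 (sq_nonneg _)
      _ ≤ Real.exp (x ^ 2) * Real.exp (-x ^ 2) :=
          mul_le_mul_of_nonneg_right h1 (Real.exp_pos _).le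
      _ = 1 := by rw [← Real.exp_add, add_neg_cancel, Real.exp_zero]
  have h4 : Real.cosh x ^ 2 * (x ^ 2 + 1) ≤ Real.cosh x ^ 2 * Real.exp (x ^ 2) :=
    mul_le_mul_of_nonneg_left (Real.add_one_le_exp _) (sq_nonneg _)
  have h5 := Real.cosh_two_mul x
  rw [Real.sinh_sq] at h5
  linarith

/-- Anti-concentration of a sum of signs, by the Paley–Zygmund inequality for its exponential. -/
theorem le_card_le_signSum {T : ℕ} {A : ℝ} (hA : 0 ≤ A) (hT : (4 * (A + 1)) ^ 2 ≤ T) :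
    Real.exp (-(4 * (A + 1)) ^ 2) / 4 * 2 ^ T ≤ (#{ε : Fin T → Bool | A * √T ≤ signSum ε} : ℝ) := by
  classical
  -- This choice gives `κ ^ 2 / 4 = A * κ + κ`: the mean `m` exceeds the value `exp (A * κ)` at the
  -- threshold by a factor of at least `exp κ ≥ 2`.
  set κ : ℝ := 4 * (A + 1) with hκ
  have hκ4 : 4 ≤ κ := by linarith
  have hT0 : (0 : ℝ) < T := by nlinarith
  have hs : 0 < √(T : ℝ) := Real.sqrt_pos.mpr hT0
  have hss : √(T : ℝ) ^ 2 = T := Real.sq_sqrt hT0.le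
  set l : ℝ := κ / √T with hl
  have hl2 : l ^ 2 * T = κ ^ 2 := by
    rw [hl, div_pow, hss]
    field_simp
  have hl1 : l ^ 2 ≤ 1 := by
    rw [hl, div_pow, hss]
    exact (div_le_one hT0).mpr hT
  set m : ℝ := Real.cosh l ^ T with hm
  have hmpos : 0 < m := pow_pos (Real.cosh_pos _) _
  have hm_ge : Real.exp (κ ^ 2 / 4) ≤ m := by
    calc Real.exp (κ ^ 2 / 4) = Real.exp (l ^ 2 / 4) ^ T := by
          rw [← Real.exp_nat_mul, ← hl2]
          congr 1
          ring
      _ ≤ m := pow_le_pow_left₀ (Real.exp_pos _).le (exp_sq_div_four_le_cosh hl1) _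
  have hsecond : Real.cosh (2 * l) ^ T ≤ m ^ 2 * Real.exp (κ ^ 2) := by
    calc Real.cosh (2 * l) ^ T ≤ (Real.cosh l ^ 2 * Real.exp (l ^ 2)) ^ T :=
          pow_le_pow_left₀ (Real.cosh_pos _).le (cosh_two_mul_le l) _
      _ = m ^ 2 * Real.exp (κ ^ 2) := by
          rw [mul_pow, ← Real.exp_nat_mul, ← hl2, hm, ← pow_mul, ← pow_mul, mul_comm 2 T,
            mul_comm (T : ℝ)]
  let X : (Fin T → Bool) → ℝ := fun ε => Real.exp (l * signSum ε)
  let B : Finset (Fin T → Bool) := {ε | A * √T ≤ signSum ε}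
  have hsmall : ∀ ε ∉ B, X ε ≤ m / 2 := by
    intro ε hε
    have hlt : signSum ε < A * √T := by simpa [B] using hε
    have h1 : l * signSum ε ≤ A * κ := by
      have : l * signSum ε ≤ l * (A * √T) := mul_le_mul_of_nonneg_left hlt.le (by positivity)
      have h2 : l * (A * √T) = A * κ := by
        rw [hl]
        field_simp
      linarith
    have h2 : 2 ≤ Real.exp κ := by
      have := Real.add_one_le_exp κ
      linarith
    have h3 : Real.exp (κ ^ 2 / 4) = Real.exp (A * κ) * Real.exp κ := by
      rw [← Real.exp_add]
      congr 1
      rw [hκ]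
      ring
    have h4 : X ε ≤ Real.exp (A * κ) := Real.exp_le_exp.mpr h1
    nlinarith [Real.exp_pos (A * κ)]
  have hsum : ∑ ε, X ε = 2 ^ T * m := sum_exp_mul_signSum T l
  have hsq : ∑ ε, X ε ^ 2 = 2 ^ T * Real.cosh (2 * l) ^ T := by
    rw [← sum_exp_mul_signSum]
    refine sum_congr rfl fun ε _ => ?_
    rw [← Real.exp_nat_mul]
    congr 1
    push_cast
    ring
  -- Off `B` the variable is at most half its mean, so `B` carries at least half the total;
  -- Cauchy–Schwarz then bounds the size of `B` below.
  have hsplit : 2 ^ T * m / 2 ≤ ∑ ε ∈ B, X ε := by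
    have h1 : ∑ ε ∈ Bᶜ, X ε ≤ 2 ^ T * (m / 2) := by
      calc ∑ ε ∈ Bᶜ, X ε ≤ #Bᶜ • (m / 2) :=
            sum_le_card_nsmul _ _ _ fun ε hε => hsmall ε (mem_compl.mp hε)
        _ ≤ 2 ^ T * (m / 2) := by
            rw [nsmul_eq_mul]
            refine mul_le_mul_of_nonneg_right ?_ (by positivity)
            have := card_le_univ Bᶜ
            simp only [Fintype.card_pi, Fintype.card_bool, prod_const, card_univ,
              Fintype.card_fin] at this
            exact_mod_cast this
    have h2 := sum_add_sum_compl B X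
    linarith
  have hCS : (∑ ε ∈ B, X ε) ^ 2 ≤ #B * (2 ^ T * (m ^ 2 * Real.exp (κ ^ 2))) := by
    calc (∑ ε ∈ B, X ε) ^ 2 ≤ #B * ∑ ε ∈ B, X ε ^ 2 := sq_sum_le_card_mul_sum_sq
      _ ≤ #B * ∑ ε, X ε ^ 2 := mul_le_mul_of_nonneg_left
          (sum_le_univ_sum_of_nonneg fun _ => sq_nonneg _) (Nat.cast_nonneg _)
      _ ≤ _ := by
          rw [hsq]
          gcongr
  have hfin : (2 ^ T * m / 2) ^ 2 ≤ #B * (2 ^ T * (m ^ 2 * Real.exp (κ ^ 2))) :=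
    (pow_le_pow_left₀ (by positivity) hsplit 2).trans hCS
  have hE : Real.exp (-κ ^ 2) * Real.exp (κ ^ 2) = 1 := by
    rw [← Real.exp_add, neg_add_cancel, Real.exp_zero]
  have hpos : 0 < 2 ^ T * (m ^ 2 * Real.exp (κ ^ 2)) := by positivity
  refine le_of_mul_le_mul_right ?_ hpos
  refine le_trans (le_of_eq ?_) hfin
  calc Real.exp (-κ ^ 2) / 4 * 2 ^ T * (2 ^ T * (m ^ 2 * Real.exp (κ ^ 2)))
      = (2 ^ T * m / 2) ^ 2 * (Real.exp (-κ ^ 2) * Real.exp (κ ^ 2)) := by ring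
    _ = (2 ^ T * m / 2) ^ 2 := by rw [hE, mul_one]

end CoinSums

/-! ### The oblivious adversary -/

section Oblivious

open Finset

/-- The oblivious adversary whose rewards are independent fair coin flips. -/
noncomputable def coinFlips (K D T : ℕ) : Adversary K D where
  Seed := Fin T → Fin K → Bool
  law := ProbabilityTheory.uniformOn Set.univ
  probLaw := ProbabilityTheory.isProbabilityMeasure_uniformOn Set.finite_univ Set.univ_nonempty
  reward t θ _ i _ := if h : t < T then (if θ ⟨t, h⟩ i then 1 else 0) else 0
  reward_mem t θ h i d := by
    split_ifs <;> simp
  measurable_reward t h i d := measurable_of_finite _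

theorem card_forall_mem {α : Type*} [Fintype α] [DecidableEq α] {T K : ℕ}
    (A : Finset (Fin T → α)) :
    #{θ : Fin T → Fin K → α | ∀ i, (fun t => θ t i) ∈ A} = #A ^ K := by
  classical
  have : #(Fintype.piFinset fun _ : Fin K => A) = #A ^ K := by simp
  rw [← this]
  refine card_bij' (fun θ _ i t => θ t i) (fun θ _ t i => θ i t) ?_ ?_ ?_ ?_ <;> simp

theorem card_apply_mem {α : Type*} [Fintype α] [DecidableEq α] {T K : ℕ}
    (A : Finset (Fin T → α)) (i : Fin K) :
    #{θ : Fin T → Fin K → α | (fun t => θ t i) ∈ A} =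
      #A * Fintype.card (Fin T → α) ^ (K - 1) := by
  classical
  have : #(Fintype.piFinset fun j : Fin K => if j = i then A else univ) =
      #A * Fintype.card (Fin T → α) ^ (K - 1) := by
    rw [Fintype.card_piFinset, ← mul_prod_erase univ _ (mem_univ i), if_pos rfl]
    congr 1
    rw [prod_congr rfl fun j hj => by rw [if_neg (ne_of_mem_erase hj)], prod_const,
      card_erase_of_mem (mem_univ i), card_univ, card_univ, Fintype.card_fin]
  rw [← this]
  refine card_bij' (fun θ _ i t => θ t i) (fun θ _ t i => θ i t) ?_ ?_ ?_ ?_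
  · intro θ hθ
    rw [Fintype.mem_piFinset]
    intro j
    split_ifs with h
    · subst h
      simpa using hθ
    · exact mem_univ _
  · intro θ hθ
    simpa using Fintype.mem_piFinset.mp hθ i
  · simp
  · simp

theorem sum_coin_eq {T : ℕ} (ε : Fin T → Bool) :
    (∑ t, if ε t then (1 : ℝ) else 0) = (T + signSum ε) / 2 := by
  have h : ∀ t, (if ε t then (1 : ℝ) else 0) = (1 + (sgn (ε t) : ℝ)) / 2 := by
    intro t
    cases ε t <;> simp [sgn]
  rw [sum_congr rfl fun t _ => h t, ← sum_div, sum_add_distrib]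
  simp [signSum]

theorem coinFlips_armReward {K D T : ℕ} (alg : Algorithm K D) (ω : alg.Seed)
    (θ : Fin T → Fin K → Bool) (t : ℕ) (i : Fin K) (d : Fin D) :
    armReward alg (coinFlips K D T) ω θ t i d =
      if h : t < T then (if θ ⟨t, h⟩ i then 1 else 0) else 0 := rfl

theorem coinFlips_armTotal {K D T : ℕ} (alg : Algorithm K D) (ω : alg.Seed)
    (θ : Fin T → Fin K → Bool) (i : Fin K) (d : Fin D) :
    armTotal alg (coinFlips K D T) ω θ T i d = (T + signSum fun t => θ t i) / 2 := by
  simp only [← sum_coin_eq, armTotal, Finset.sum_apply, sum_range]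
  refine sum_congr rfl fun t _ => ?_
  rw [coinFlips_armReward, dif_pos t.2]

theorem coinFlips_playerTotal {K D T : ℕ} (alg : Algorithm K D) (ω : alg.Seed)
    (θ : Fin T → Fin K → Bool) (d : Fin D) :
    playerTotal alg (coinFlips K D T) ω θ T d =
      (T + signSum fun t => θ t (action alg (coinFlips K D T) ω θ t)) / 2 := by
  simp only [← sum_coin_eq, playerTotal, Finset.sum_apply, sum_range]
  refine sum_congr rfl fun t _ => ?_
  rw [coinFlips_armReward, dif_pos t.2]

/-- The coin flips that the player receives are distributed as those of a fixed arm. -/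
theorem coinFlips_card_player_le {K D T : ℕ} (hT : 1 ≤ T) (alg : Algorithm K D) (ω : alg.Seed)
    (i : Fin K) (C : ℝ) :
    (#{θ : Fin T → Fin K → Bool |
      C * √T < signSum fun t => θ t (action alg (coinFlips K D T) ω θ t)} : ℝ) ≤
      Real.exp (1 / 2 - C) * (2 ^ T) ^ K := by
  classical
  -- Swapping, in every round, the coins of arm `i` and of the pulled arm puts the player's flips on
  -- arm `i`.
  let F : (Fin T → Fin K → Bool) → Fin T → Fin K → Bool := fun θ t j =>
    θ t (Equiv.swap i (action alg (coinFlips K D T) ω θ t) j)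
  have hF : Function.Injective F := by
    refine injective_of_triangular F fun θ θ' t h hFt => ?_
    have hact : action alg (coinFlips K D T) ω θ t = action alg (coinFlips K D T) ω θ' t := by
      refine action_congr alg (coinFlips K D T) ω fun s hs => ?_
      funext _ j _
      have hsT : s < T := hs.trans t.2
      simp only [coinFlips, hsT, dif_pos, h ⟨s, hsT⟩ hs]
    funext j
    have := congrFun hFt (Equiv.swap i (action alg (coinFlips K D T) ω θ t) j)
    simpa only [F, ← hact, Equiv.swap_apply_self] using this
  have hK : K - 1 + 1 = K := by have := i.2; omega
  have hcard : #{θ : Fin T → Fin K → Bool |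
      C * √T < signSum fun t => θ t (action alg (coinFlips K D T) ω θ t)} ≤
      #{θ : Fin T → Fin K → Bool | (fun t => θ t i) ∈
        ({ε | C * √T < signSum ε} : Finset (Fin T → Bool))} := by
    refine card_le_card_of_injOn F (fun θ hθ => ?_) hF.injOn
    simpa [F] using hθ
  rw [card_apply_mem] at hcard
  calc _ ≤ ((#({ε | C * √T < signSum ε} : Finset (Fin T → Bool)) *
        Fintype.card (Fin T → Bool) ^ (K - 1) : ℕ) : ℝ) := by exact_mod_cast hcard
    _ ≤ (Real.exp (1 / 2 - C) * 2 ^ T) * (2 ^ T) ^ (K - 1) := by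
        push_cast
        simp only [Fintype.card_pi, Fintype.card_bool, prod_const, card_univ, Fintype.card_fin]
        push_cast
        exact mul_le_mul_of_nonneg_right (card_lt_signSum_le hT C) (by positivity)
    _ = Real.exp (1 / 2 - C) * (2 ^ T) ^ K := by
        rw [mul_assoc, ← pow_succ', hK]

theorem coinFlips_card_arms_le {K T : ℕ} {A : ℝ} (hA : 0 ≤ A) (hT : (4 * (A + 1)) ^ 2 ≤ T) :
    (#{θ : Fin T → Fin K → Bool | ∀ i, (signSum fun t => θ t i) < A * √T} : ℝ) ≤
      (1 - Real.exp (-(4 * (A + 1)) ^ 2) / 4) ^ K * (2 ^ T) ^ K := by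
  classical
  have h1 : #{θ : Fin T → Fin K → Bool | ∀ i, (signSum fun t => θ t i) < A * √T} =
      #({ε | signSum ε < A * √T} : Finset (Fin T → Bool)) ^ K := by
    rw [← card_forall_mem]
    simp
  have h2 : (#({ε | signSum ε < A * √T} : Finset (Fin T → Bool)) : ℝ) +
      #({ε | A * √T ≤ signSum ε} : Finset (Fin T → Bool)) = 2 ^ T := by
    have := card_filter_add_card_filter_not (s := (univ : Finset (Fin T → Bool)))
      (fun ε => signSum ε < A * √T)
    simp only [not_lt, card_univ, Fintype.card_pi, Fintype.card_bool, prod_const,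
      Fintype.card_fin] at this
    exact_mod_cast this
  have h3 := le_card_le_signSum hA hT
  rw [h1, ← mul_pow]
  push_cast
  exact pow_le_pow_left₀ (Nat.cast_nonneg _) (by linarith) K

/-- Outside two bad events the player's signs sum to at most `C * √T` and some arm's to at least `(C
+ 3) * √T`. Rewards are half the signs up to a constant, so the gap is at least `3 / 2 * √T`. -/
theorem coinFlips_card_le {K D T : ℕ} (hK : 1 ≤ K) (hD : 1 ≤ D) (hT1 : 1 ≤ T) {C : ℝ} (hC : 0 ≤ C)
    (hT : (4 * (C + 3 + 1)) ^ 2 ≤ T) (alg : Algorithm K D) (ω : alg.Seed) :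
    (Nat.card {θ : Fin T → Fin K → Bool //
      ¬ √T < paretoRegret alg (coinFlips K D T) T ω θ} : ℝ) ≤
      (Real.exp (1 / 2 - C) + (1 - Real.exp (-(4 * (C + 3 + 1)) ^ 2) / 4) ^ K) * (2 ^ T) ^ K := by
  classical
  have hrep : (coinFlips K D T).HasRepeatedRewards := fun _ _ _ _ _ _ => rfl
  have hs : 0 < √(T : ℝ) := Real.sqrt_pos.mpr (by exact_mod_cast hT1)
  let P : Finset (Fin T → Fin K → Bool) :=
    {θ | C * √T < signSum fun t => θ t (action alg (coinFlips K D T) ω θ t)}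
  let Q : Finset (Fin T → Fin K → Bool) := {θ | ∀ i, (signSum fun t => θ t i) < (C + 3) * √T}
  have hcover : ∀ θ : Fin T → Fin K → Bool, ¬ √T < paretoRegret alg (coinFlips K D T) T ω θ →
      θ ∈ P ∪ Q := by
    intro θ hθ
    by_contra hcon
    simp only [P, Q, mem_union, mem_filter, mem_univ, true_and, not_or, not_lt, not_forall] at hcon
    obtain ⟨hp, i, hi⟩ := hcon
    refine hθ (lt_paretoRegret alg (coinFlips K D T) ω hrep θ T ⟨0, hD⟩ i hs.le ?_)
    rw [coinFlips_armTotal, coinFlips_playerTotal]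
    linarith
  have hle := Nat.card_le_card_of_injective
    (fun θ : {θ : Fin T → Fin K → Bool // ¬ √T < paretoRegret alg (coinFlips K D T) T ω θ} =>
      (⟨θ.1, hcover θ.1 θ.2⟩ : ↥(P ∪ Q)))
    (fun θ θ' h => Subtype.ext (congrArg (fun x => x.1) h))
  rw [Nat.card_eq_finsetCard] at hle
  have h1 : (Nat.card {θ : Fin T → Fin K → Bool //
      ¬ √T < paretoRegret alg (coinFlips K D T) T ω θ} : ℝ) ≤ _ :=
    Nat.cast_le.mpr (hle.trans (card_union_le _ _))
  refine h1.trans ?_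
  push_cast
  rw [add_mul]
  exact add_le_add (coinFlips_card_player_le hT1 alg ω ⟨0, hK⟩ C)
    (coinFlips_card_arms_le (by linarith) hT)

end Oblivious

end MOMAB

/-! ### Choice of constants -/

open MOMAB in
theorem exists_adaptive_adversary {δ : ℝ} (hδ : 0 < δ) :
    ∃ c : ℝ, 0 < c ∧ ∃ T₀ : ℕ, ∀ K D T : ℕ, 2 ≤ K → 1 ≤ D → T₀ ≤ T →
      ∃ adv : Adversary K D, adv.HasRepeatedRewards ∧
        ∀ alg : Algorithm K D, 1 - δ ≤ probRegretGT alg adv T (c * √T) := by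
  -- This makes `δ / 8 * √T ≥ 1` and `√T ≥ 1`, so rounding up at most doubles these quantities. The
  -- level `a` then lies between `δ / 8 * √T` and `δ / 4 * √T`, and the failure probability is at
  -- most `2 * a * L / T ≤ δ`.
  obtain ⟨T₀, hT₀⟩ := exists_nat_ge (1 + (8 / δ) ^ 2)
  refine ⟨δ / 16, by positivity, T₀, fun K D T hK hD hT => ?_⟩
  have hTr : 1 + (8 / δ) ^ 2 ≤ (T : ℝ) := hT₀.trans (by exact_mod_cast hT)
  have hT0 : (0 : ℝ) < T := by nlinarith [sq_nonneg (8 / δ)]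
  have hss : √(T : ℝ) ^ 2 = T := Real.sq_sqrt hT0.le
  have hs8 : 8 / δ ≤ √T := Real.le_sqrt_of_sq_le (by linarith)
  have hs1 : 1 ≤ √(T : ℝ) := Real.le_sqrt_of_sq_le (by nlinarith [sq_nonneg (8 / δ)])
  have hs8' : 8 ≤ δ * √T := by
    rw [div_le_iff₀ hδ] at hs8
    linarith
  set a : ℕ := ⌊δ / 8 * √T⌋₊ + 1 with ha
  set L : ℕ := ⌈√(T : ℝ)⌉₊ with hL
  have ha1 : δ / 8 * √T < a := by
    rw [ha]
    push_cast
    exact Nat.lt_floor_add_one _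
  have ha2 : (a : ℝ) ≤ δ / 4 * √T := by
    have := Nat.floor_le (a := δ / 8 * √T) (by positivity)
    rw [ha]
    push_cast
    linarith
  have hL1 : √(T : ℝ) ≤ L := Nat.le_ceil _
  have hL2 : (L : ℝ) ≤ 2 * √T := by
    have := Nat.ceil_lt_add_one (Real.sqrt_nonneg (T : ℝ))
    linarith
  have hTL : T ≤ L ^ 2 := by
    have : (T : ℝ) ≤ (L : ℝ) ^ 2 := hss ▸ pow_le_pow_left₀ (Real.sqrt_nonneg _) hL1 2
    exact_mod_cast this
  refine ⟨hitAndStop K D T a, fun _ _ _ _ _ _ => rfl, fun alg => ?_⟩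
  refine one_sub_le_prod_uniformOn_real (Θ := Fin T → Bool) alg.law _ δ fun ω => ?_
  have hcard : (Nat.card {θ : Fin T → Bool //
      ¬ δ / 16 * √T < paretoRegret alg (hitAndStop K D T a) T ω θ} : ℝ) ≤
      (survivors T a).card := by
    refine Nat.cast_le.mpr (hitAndStop_card_le hK hD a (by positivity) ?_ alg ω)
    push_cast
    linarith
  refine hcard.trans ?_
  have hsurv := card_survivors_le hTL T le_rfl a (Int.natCast_nonneg a)
  have hmax : (L : ℤ) ^ 2 - (max ((L : ℤ) - a) 0) ^ 2 ≤ 2 * a * L := by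
    rcases le_total ((L : ℤ) - a) 0 with h | h
    · rw [max_eq_right h]
      nlinarith
    · rw [max_eq_left h]
      nlinarith
  have hsurv' : (T : ℤ) * (survivors T (a : ℤ)).card ≤ 2 ^ T * (2 * a * L) := by
    refine hsurv.trans (mul_le_mul_of_nonneg_left ?_ (by positivity))
    linarith
  have hsurvR : (T : ℝ) * (survivors T (a : ℤ)).card ≤ 2 ^ T * (2 * a * L) := by
    exact_mod_cast hsurv'
  have haL : (a : ℝ) * L ≤ δ / 4 * √T * (2 * √T) :=
    mul_le_mul ha2 hL2 (Nat.cast_nonneg _) (by positivity)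
  have hcube : (Fintype.card (Fin T → Bool) : ℝ) = 2 ^ T := by simp
  rw [hcube]
  refine le_of_mul_le_mul_left (hsurvR.trans ?_) hT0
  have : 2 * (a : ℝ) * L ≤ T * δ := by nlinarith
  calc (2 : ℝ) ^ T * (2 * a * L) ≤ 2 ^ T * (T * δ) :=
        mul_le_mul_of_nonneg_left this (by positivity)
    _ = T * (δ * 2 ^ T) := by ring

open MOMAB in
theorem exists_oblivious_adversary {δ : ℝ} (hδ : 0 < δ) (hδ' : δ < 1) :
    ∃ K₀ T₀ : ℕ, ∀ K D T : ℕ, K₀ ≤ K → 1 ≤ D → T₀ ≤ T →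
      ∃ adv : Adversary K D, adv.HasRepeatedRewards ∧ adv.IsOblivious ∧
        ∀ alg : Algorithm K D, 1 - δ ≤ probRegretGT alg adv T √T := by
  -- The failure probability `δ` is split evenly: `C` allots `δ / 2` to a lucky player, and the
  -- number of arms makes the chance `q ^ K` that no arm is high at most `δ / 2`.
  set C : ℝ := 1 / 2 - Real.log (δ / 2) with hC
  have hC0 : 0 ≤ C := by
    have := Real.log_nonpos (by linarith : 0 ≤ δ / 2) (by linarith)
    linarith
  have hexp : Real.exp (1 / 2 - C) = δ / 2 := by
    rw [hC, sub_sub_cancel, Real.exp_log (by linarith)]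
  set q : ℝ := 1 - Real.exp (-(4 * (C + 3 + 1)) ^ 2) / 4 with hq
  have hq1 : q < 1 := by
    have := Real.exp_pos (-(4 * (C + 3 + 1)) ^ 2)
    linarith
  have hq0 : 0 ≤ q := by
    have : Real.exp (-(4 * (C + 3 + 1)) ^ 2) ≤ 1 :=
      Real.exp_le_one_iff.mpr (by nlinarith [sq_nonneg (4 * (C + 3 + 1))])
    linarith
  obtain ⟨n, hn⟩ := exists_pow_lt_of_lt_one (by linarith : 0 < δ / 2) hq1
  obtain ⟨m, hm⟩ := exists_nat_ge ((4 * (C + 3 + 1)) ^ 2)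
  refine ⟨n + 1, m + 1, fun K D T hK hD hT => ?_⟩
  have hTm : (4 * (C + 3 + 1)) ^ 2 ≤ (T : ℝ) := hm.trans (by exact_mod_cast (by omega : m ≤ T))
  refine ⟨coinFlips K D T, fun _ _ _ _ _ _ => rfl, fun _ _ _ _ => rfl, fun alg => ?_⟩
  refine one_sub_le_prod_uniformOn_real (Θ := Fin T → Fin K → Bool) alg.law _ δ fun ω => ?_
  have h := coinFlips_card_le (by omega) hD (by omega) hC0 hTm alg ω (K := K)
  refine h.trans ?_
  have hcube : (Fintype.card (Fin T → Fin K → Bool) : ℝ) = (2 ^ T) ^ K := by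
    simp [← pow_mul, mul_comm]
  rw [hcube, hexp, ← hq]
  have hqK : q ^ K ≤ δ / 2 := (pow_le_pow_of_le_one hq0 hq1.le (by omega)).trans hn.le
  exact mul_le_mul_of_nonneg_right (by linarith) (by positivity)

theorem theorem8 (δ : ℝ) (hδ : 0 < δ) (hδ' : δ < 1) :
    (∃ c : ℝ, 0 < c ∧ ∃ T₀ : ℕ, ∀ K D T : ℕ, 2 ≤ K → 1 ≤ D → T₀ ≤ T →
      ∃ adv : MOMAB.Adversary K D, adv.HasRepeatedRewards ∧
        ∀ alg : MOMAB.Algorithm K D,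
          1 - δ ≤ MOMAB.probRegretGT alg adv T (c * Real.sqrt T)) ∧
    (∃ K₀ T₀ : ℕ, ∀ K D T : ℕ, K₀ ≤ K → 1 ≤ D → T₀ ≤ T →
      ∃ adv : MOMAB.Adversary K D, adv.HasRepeatedRewards ∧ adv.IsOblivious ∧
        ∀ alg : MOMAB.Algorithm K D,
          1 - δ ≤ MOMAB.probRegretGT alg adv T (Real.sqrt T)) :=
  ⟨exists_adaptive_adversary hδ, exists_oblivious_adversary hδ hδ'⟩
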